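/- Let $\eta$ be an ordinal, let $[0,\eta]$ be equipped with the order topology (so that it is a compact Hausdorff space), let $\mathbb K\in\{\mathbb R,\mathbb C\}$, and let $C([0,\eta])$ be the Banach space of $\mathbb K$-valued continuous functions on $[0,\eta]$ with the supremum norm. Identify its dual $C([0,\eta])^*$ with the space $\mathcal M([0,\eta])$ of $\mathbb K$-valued Radon measures on $[0,\eta]$ via $\mu(f)=\int f\,d\mu$, and set $$D(\eta)=\{\mu\in \mathcal M([0,\eta]) : \mu(\{x\})=0 \text{ for each } x\in[0,\eta] \text{ with uncountable cofinality}\}.$$ For a Banach space $X$, a set $D\subset X^*$ is a $\Sigma$-subspace of $X^*$ if there is a linearly dense set $M\subset X$ such that $D=\{x^*\in X^* : \{x\in M : x^*(x)\neq 0\} \text{ is countable}\}$; it is $1$-norming if $\|x\|=\sup\{|x^*(x)| : x^*\in D,\ \|x^*\|\le 1\}$ for each $x\in X$; and $X$ is $1$-Plichko if $X^*$ admits a $1$-norming $\Sigma$-subspace. Then the following assertions are equivalent: 1. $C([0,\eta])$ is $1$-Plichko. 2. $D(\eta)$ is a $\Sigma$-subspace of $C([0,\eta])^*$. 3. $\eta<\omega_2$.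 -/

import Mathlib

open MeasureTheory
open scoped Ordinal Cardinal

universe u

section Banach

variable {𝕜 : Type*} [RCLike 𝕜] {X : Type*} [NormedAddCommGroup X] [NormedSpace 𝕜 X]

variable (𝕜) in
/-- The linear subspace of `X*` formed by the functionals which are nonzero at only countably many
elements of `M`. -/
def sigmaSubspace (M : Set X) : Submodule 𝕜 (StrongDual 𝕜 X) where
  carrier := {φ : StrongDual 𝕜 X | {x ∈ M | φ x ≠ 0}.Countable}
  zero_mem' := by simp
  add_mem' := by
    intro φ ψ hφ hψ
    refine (Set.Countable.union hφ hψ).mono ?_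
    rintro x ⟨hxM, hx⟩
    by_cases h : φ x = 0
    · exact Or.inr ⟨hxM, fun h' => hx (by simp [h, h'])⟩
    · exact Or.inl ⟨hxM, h⟩
  smul_mem' := by
    intro c φ hφ
    refine Set.Countable.mono ?_ hφ
    rintro x ⟨hxM, hx⟩
    exact ⟨hxM, fun h => hx (by simp [h])⟩

/-- A subset `D` of the dual `X*` is a Σ-subspace if there is a linearly dense set `M ⊆ X` such that
`D` consists exactly of the functionals which are nonzero at only countably many elements of `M`;
in particular `D` is then a linear subspace of `X*`. -/
def IsSigmaSubspace (D : Set (StrongDual 𝕜 X)) : Prop :=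
  ∃ M : Set X, (Submodule.span 𝕜 M).topologicalClosure = ⊤ ∧
    D = (sigmaSubspace 𝕜 M : Set (StrongDual 𝕜 X))

/-- A subset `D` of the dual `X*` is 1-norming if `‖x‖ = sup {|φ x| : φ ∈ D, ‖φ‖ ≤ 1}` for each
`x ∈ X`. -/
def IsOneNorming (D : Set (StrongDual 𝕜 X)) : Prop :=
  ∀ x : X, IsLUB ((fun φ : StrongDual 𝕜 X => ‖φ x‖) '' {φ | φ ∈ D ∧ ‖φ‖ ≤ 1}) ‖x‖

variable (𝕜 X) in
/-- The space `X` is 1-Plichko if `X*` admits a 1-norming Σ-subspace. -/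
def IsOnePlichko : Prop :=
  ∃ D : Set (StrongDual 𝕜 X), IsSigmaSubspace D ∧ IsOneNorming D

end Banach

section Measures

variable {𝕜 : Type*} [RCLike 𝕜] {K : Type*} [TopologicalSpace K] [MeasurableSpace K] [BorelSpace K]

/-- A 𝕜-valued Borel measure is Radon if its total variation is a finite regular measure. -/
def IsRadon (μ : VectorMeasure K 𝕜) : Prop :=
  IsFiniteMeasure μ.variation ∧ μ.variation.Regular

/-- The functional `φ` on `C(K)` corresponds to the Radon measure `μ` under the Riesz
identification: `φ f = ∫ f dμ` for each continuous `f`. -/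
def Represents (μ : VectorMeasure K 𝕜) (φ : StrongDual 𝕜 C(K, 𝕜)) : Prop :=
  IsRadon μ ∧ ∀ f : C(K, 𝕜), φ f = μ.integral f (ContinuousLinearMap.mul ℝ 𝕜)

end Measures

/-- The ordinal segment `[0, η]`; its topology is the order topology. -/
abbrev OrdinalSegment (η : Ordinal.{u}) : Type (u + 1) := Set.Icc (0 : Ordinal.{u}) η

instance OrdinalSegment.instMeasurableSpace (η : Ordinal.{u}) :
    MeasurableSpace (OrdinalSegment η) := borel _

instance OrdinalSegment.instBorelSpace (η : Ordinal.{u}) : BorelSpace (OrdinalSegment η) := ⟨rfl⟩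

/-- `D(η)`: the functionals on `C([0, η])` given by Radon measures `μ` on `[0, η]` with `μ {x} = 0`
for each `x ∈ [0, η]` of uncountable cofinality. -/
def ordinalD (𝕜 : Type*) [RCLike 𝕜] (η : Ordinal.{u}) :
    Set (StrongDual 𝕜 C(OrdinalSegment η, 𝕜)) :=
  {φ | ∃ μ : VectorMeasure (OrdinalSegment η) 𝕜, Represents μ φ ∧
    ∀ x : OrdinalSegment η, ℵ₀ < (x : Ordinal.{u}).cof → μ {x} = 0}

/-! Every functional on $C([0,\eta])$ is atomic, $f\mapsto\sum a(x)f(x)$ with $a\in\ell^1$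
(`exists_eq_atomicFunctional`), so $D(\eta)$ is the set of those with $a=0$ at all points of
uncountable cofinality.

(3 → 2) `exists_isIntervalBasis` gives a family of clopen intervals $(c,d]$ such that a point of
countable cofinality lies in only countably many, a point $x$ of uncountable cofinality is the right
end of uncountably many with left end beyond any given $c<x$, and the indicators together with 1 are
linearly dense. Countable support then gives one inclusion. For the other, a nonzero $a(x)$ is
detected by all short intervals ending at $x$.

(2 → 1) $D(\eta)$ contains the evaluations at the dense set of points of countable cofinality.

(1 → 3) For a 1-norming Σ-subspace given by $M$, only countably many $f\in M$ are nonzero at an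
isolated point (`countable_of_isolated`), but uncountably many at a point of uncountable cofinality
(`not_countable_of_aleph0_lt_cof`). If $\eta\ge\omega_2$, closing off yields $\delta<\omega_2$ of
uncountable cofinality such that every $f\in M$ with $f(\delta)\ne0$ is constant on
$[\delta,\omega_2]$, hence nonzero at the isolated point $\delta+1$: a contradiction. -/

section Proofs

open Topology Filter Set
open scoped ENNReal

/-! ### Indicators of clopen intervals -/

section IntervalFunctions

variable (𝕜 : Type*) [RCLike 𝕜]

theorem Ordinal.isClopen_Ioc (c d : Ordinal.{u}) : IsClopen (Ioc c d) := by
  have h (e : Ordinal.{u}) : IsClopen (Iic e) := by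
    refine ⟨isClosed_Iic, ?_⟩
    rw [← Order.Iio_succ]
    exact isOpen_Iio
  rw [← Ioi_inter_Iic, ← compl_Iic]
  exact (h c).compl.inter (h d)

/-- The indicator function of the clopen subset `(c, d]` of `[0, η]`. -/
noncomputable def iocIndicator (η c d : Ordinal.{u}) : C(OrdinalSegment η, 𝕜) where
  toFun := ((↑) ⁻¹' Ioc c d : Set (OrdinalSegment η)).indicator 1
  continuous_toFun :=
    ((Ordinal.isClopen_Ioc c d).preimage continuous_subtype_val).continuous_indicator
      continuous_const

open Classical in
theorem iocIndicator_apply (η c d : Ordinal.{u}) (x : OrdinalSegment η) :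
    iocIndicator 𝕜 η c d x = if c < x ∧ x ≤ d then 1 else 0 := by
  change indicator _ _ _ = _
  simp [indicator_apply]

theorem norm_iocIndicator_apply_le (η c d : Ordinal.{u}) (x : OrdinalSegment η) :
    ‖iocIndicator 𝕜 η c d x‖ ≤ 1 := by
  classical
  rw [iocIndicator_apply]
  split_ifs <;> simp

theorem iocIndicator_eq_sub {η c d : Ordinal.{u}} (h : c ≤ d) :
    iocIndicator 𝕜 η c d = iocIndicator 𝕜 η c η - iocIndicator 𝕜 η d η := by
  classical
  ext x
  have hx := x.2.2
  simp only [ContinuousMap.sub_apply, iocIndicator_apply]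
  grind

theorem iocIndicator_mul (η c d : Ordinal.{u}) :
    iocIndicator 𝕜 η c η * iocIndicator 𝕜 η d η = iocIndicator 𝕜 η (max c d) η := by
  classical
  ext x
  have hx := x.2.2
  simp only [ContinuousMap.mul_apply, iocIndicator_apply]
  grind

/-- The indicators of final segments, together with the constants, are linearly dense. -/
theorem span_iocIndicator_dense (η : Ordinal.{u}) :
    (Submodule.span 𝕜 (insert 1 (range fun c => iocIndicator 𝕜 η c η))).topologicalClosure = ⊤ := by
  classical
  set s : Set C(OrdinalSegment η, 𝕜) := range fun c => iocIndicator 𝕜 η c η with hs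
  have hmul : ∀ x ∈ insert 1 s, ∀ y ∈ insert 1 s, x * y ∈ insert 1 s := by
    rintro x (rfl | ⟨c, rfl⟩) y (rfl | ⟨d, rfl⟩)
    · simp
    · simp [hs]
    · simp [hs]
    · exact Or.inr ⟨max c d, (iocIndicator_mul 𝕜 η c d).symm⟩
  have hstar : ∀ x ∈ insert 1 s, star x = x := by
    rintro x (rfl | ⟨c, rfl⟩)
    · simp
    · ext x
      simp only [ContinuousMap.star_apply, iocIndicator_apply]
      split_ifs <;> simp
  -- The generators are self-adjoint and closed under products, so their span is already a star
  -- subalgebra and Stone–Weierstrass applies.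
  let A : StarSubalgebra 𝕜 C(OrdinalSegment η, 𝕜) :=
    { (Submodule.span 𝕜 (insert 1 s)) with
      mul_mem' := by
        intro a b ha hb
        have := Submodule.mul_mem_mul ha hb
        rw [Submodule.span_mul_span] at this
        refine Submodule.span_mono ?_ this
        rintro _ ⟨x, hx, y, hy, rfl⟩
        exact hmul x hx y hy
      algebraMap_mem' := by
        intro r
        rw [Algebra.algebraMap_eq_smul_one]
        exact Submodule.smul_mem _ _ (Submodule.subset_span (by simp))
      star_mem' := by
        intro a ha
        change a ∈ Submodule.span 𝕜 (insert 1 s) at ha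
        change star a ∈ Submodule.span 𝕜 (insert 1 s)
        induction ha using Submodule.span_induction with
        | mem x hx => rw [hstar x hx]; exact Submodule.subset_span hx
        | zero => simp
        | add x y _ _ hx hy => rw [star_add]; exact Submodule.add_mem _ hx hy
        | smul r x _ hx => rw [star_smul]; exact Submodule.smul_mem _ _ hx }
  have hA : A.SeparatesPoints := by
    have key : ∀ x y : OrdinalSegment η, x < y →
        ∃ f ∈ (fun f : C(OrdinalSegment η, 𝕜) => (f : OrdinalSegment η → 𝕜)) ''
          (A : Set C(OrdinalSegment η, 𝕜)), f x ≠ f y := by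
      intro x y hxy
      refine ⟨_, ⟨iocIndicator 𝕜 η x η, Submodule.subset_span (Or.inr ⟨_, rfl⟩), rfl⟩, ?_⟩
      have hy := y.2.2
      have hxy' : (x : Ordinal) < y := hxy
      simp [iocIndicator_apply, hxy', hy]
    intro x y hxy
    rcases hxy.lt_or_gt with h | h
    · exact key x y h
    · obtain ⟨f, hf, hne⟩ := key y x h
      exact ⟨f, hf, hne.symm⟩
  have htop := ContinuousMap.starSubalgebra_topologicalClosure_eq_top_of_separatesPoints A hA
  refine SetLike.coe_injective ?_
  have := congrArg (fun B : StarSubalgebra 𝕜 C(OrdinalSegment η, 𝕜) =>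
    (B : Set C(OrdinalSegment η, 𝕜))) htop
  simp only [StarSubalgebra.topologicalClosure_coe, StarSubalgebra.coe_top] at this
  rw [Submodule.topologicalClosure_coe, Submodule.top_coe]
  exact this

/-- A continuous functional on `C([0, η])` is determined by its values at `1` and at the indicators
of final segments. -/
theorem clm_ext_iocIndicator {η : Ordinal.{u}} {φ ψ : StrongDual 𝕜 C(OrdinalSegment η, 𝕜)}
    (h1 : φ 1 = ψ 1) (h : ∀ c, φ (iocIndicator 𝕜 η c η) = ψ (iocIndicator 𝕜 η c η)) : φ = ψ := by
  refine ContinuousLinearMap.ext_on (s := insert 1 (range fun c => iocIndicator 𝕜 η c η)) ?_ ?_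
  · exact Submodule.dense_iff_topologicalClosure_eq_top.2 (span_iocIndicator_dense 𝕜 η)
  · rintro _ (rfl | ⟨c, rfl⟩)
    · exact h1
    · exact h c

end IntervalFunctions

/-! ### Point-countable families of intervals -/

section IntervalFamilies

theorem Ordinal.exists_countable_bound {x : Ordinal.{u}} (hx : ℵ₀ < x.cof) {A : Set Ordinal.{u}}
    (hA : A.Countable) (hAx : ∀ a ∈ A, a < x) : ∃ c < x, ∀ a ∈ A, a ≤ c := by
  have hcard : #A < (Ordinal.lift.{u + 1} x).cof := by
    rw [← Ordinal.lift_cof]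
    refine (Cardinal.le_aleph0_iff_set_countable.2 hA).trans_lt ?_
    rwa [Cardinal.aleph0_lt_lift]
  exact ⟨sSup A, Ordinal.sSup_lt_of_lt_cof hcard hAx,
    fun a ha => le_csSup ⟨x, fun b hb => (hAx b hb).le⟩ ha⟩

/-- Ordinals below `ω₂` have cofinal subsets with countable proper initial segments. -/
theorem Ordinal.exists_cofinal_countable_initial {b : Ordinal.{u}} (hb : b < ω_ 2) :
    ∃ S : Set Ordinal.{u}, (∀ s ∈ S, s < b) ∧ (∀ c < b, ∃ s ∈ S, c ≤ s) ∧
      (b.cof ≤ ℵ₀ → S.Countable) ∧ ∀ x < b, {s ∈ S | s < x}.Countable := by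
  -- `S` has order type the initial ordinal of `b.cof`, which is at most `ω_ 1` because `b < ω_ 2`;
  -- hence its proper initial segments are countable.
  obtain ⟨S, hS, hcard⟩ := Ordinal.exists_ord_cof_eq (Iio b)
  have hcof : Order.cof (Iio b) = Cardinal.lift.{u + 1} b.cof := by
    rw [Ordinal.cof_Iio, Ordinal.lift_cof]
  have hmk : #S = Cardinal.lift.{u + 1} b.cof := by
    rw [← Ordinal.card_type (α := S) (· < ·), hcard, Cardinal.card_ord, hcof]
  have hle : b.cof ≤ ℵ_ 1 := by
    have h1 : b.cof < ℵ_ 2 := by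
      refine (Ordinal.cof_le_card b).trans_lt ?_
      rw [← Cardinal.lt_ord]
      simpa using hb
    rwa [← one_add_one_eq_two, ← Cardinal.succ_aleph, Order.lt_succ_iff] at h1
  refine ⟨(↑) '' S, ?_, ?_, ?_, ?_⟩
  · rintro _ ⟨s, -, rfl⟩
    exact s.2
  · intro c hc
    obtain ⟨s, hs, hcs⟩ := hS ⟨c, hc⟩
    exact ⟨s, ⟨s, hs, rfl⟩, hcs⟩
  · intro h
    refine Set.Countable.image ?_ _
    rw [← Cardinal.le_aleph0_iff_set_countable, hmk]
    rwa [Cardinal.lift_le_aleph0]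
  · intro x hx
    obtain ⟨t, ht, hxt⟩ := hS ⟨x, hx⟩
    have hlt : Ordinal.typein (α := S) (· < ·) ⟨t, ht⟩ < ω_ 1 := by
      refine (Ordinal.typein_lt_type (α := S) (· < ·) ⟨t, ht⟩).trans_le ?_
      rw [hcard, hcof, ← Cardinal.ord_aleph, Cardinal.ord_le_ord,
        show (ℵ_ 1 : Cardinal.{u + 1}) = Cardinal.lift.{u + 1, u} (ℵ_ 1) by simp, Cardinal.lift_le]
      exact hle
    have hlt' : #{s : S // s < ⟨t, ht⟩} ≤ ℵ₀ := by
      rw [← Cardinal.ord_aleph, Cardinal.lt_ord, Ordinal.card_typein] at hlt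
      rwa [← Cardinal.aleph_zero, ← Order.lt_succ_iff, Cardinal.succ_aleph, zero_add]
    have : Countable {s : S // s < ⟨t, ht⟩} := Cardinal.mk_le_aleph0_iff.1 hlt'
    refine (Set.countable_range (fun s : {s : S // s < ⟨t, ht⟩} => (s.1.1 : Ordinal))).mono ?_
    rintro _ ⟨⟨s, hs, rfl⟩, hsx⟩
    exact ⟨⟨⟨s, hs⟩, Subtype.coe_lt_coe.1 (lt_of_lt_of_le (show s < ⟨x, hx⟩ from hsx) hxt)⟩, rfl⟩

/-- A family of pairs `c < d` in `[a, b]`, thought of as intervals `(c, d]`, that is point-countable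
exactly at the points of at most countable cofinality, and connects all points of `[a, b]`. -/
structure IsIntervalBasis (a b : Ordinal.{u}) (U : Set (Ordinal.{u} × Ordinal.{u})) : Prop where
  bounds : ∀ p ∈ U, a ≤ p.1 ∧ p.1 < p.2 ∧ p.2 ≤ b
  countable : ∀ x : Ordinal.{u}, x.cof ≤ ℵ₀ → {p ∈ U | p.1 < x ∧ x ≤ p.2}.Countable
  not_countable : ∀ x : Ordinal.{u}, ℵ₀ < x.cof → a < x → x ≤ b → ∀ c < x,
    ¬ {p ∈ U | c ≤ p.1 ∧ p.2 = x}.Countable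
  connected : ∀ c, a ≤ c → c ≤ b → Relation.EqvGen (fun c d => (c, d) ∈ U) c b

/-- Induction on `b`. Take `T` cofinal in `b` with countable proper initial segments, use all `(t,
b]` with `t ∈ T`, and fill each gap `(p s, s]` of `T` by the induction hypothesis. -/
theorem exists_isIntervalBasis (b : Ordinal.{u}) : ∀ a ≤ b, b < ω_ 2 →
    ∃ U, IsIntervalBasis a b U := by
  induction b using WellFoundedLT.induction with
  | ind b ih =>
  intro a hab hb
  obtain rfl | hab := hab.eq_or_lt
  · exact ⟨∅, by simp, by simp, fun x _ h h' => absurd (h.trans_le h') (lt_irrefl _), fun c h h' => by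
      rw [le_antisymm h' h]; exact .refl _⟩
  obtain ⟨S, hSb, hScof, hScount, hSinit⟩ := Ordinal.exists_cofinal_countable_initial hb
  set T : Set Ordinal.{u} := insert a {s ∈ S | a < s} with hT
  have hTb : ∀ t ∈ T, t < b := by
    rintro t (rfl | h)
    · exact hab
    · exact hSb t h.1
  have hTa : ∀ t ∈ T, a ≤ t := by
    rintro t (rfl | h)
    · exact le_rfl
    · exact h.2.le
  have hTcof : ∀ c < b, ∃ t ∈ T, c ≤ t := by
    intro c hc
    obtain ⟨s, hs, hcs⟩ := hScof c hc
    by_cases h : a < s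
    · exact ⟨s, Or.inr ⟨hs, h⟩, hcs⟩
    · exact ⟨a, Or.inl rfl, hcs.trans (not_lt.1 h)⟩
  have hTcount : b.cof ≤ ℵ₀ → T.Countable := fun h =>
    ((hScount h).mono (sep_subset _ _)).insert a
  have hTinit : ∀ x < b, {t ∈ T | t < x}.Countable := fun x hx => by
    refine ((hSinit x hx).insert a).mono ?_
    rintro t ⟨rfl | h, htx⟩
    · exact Or.inl rfl
    · exact Or.inr ⟨h.1, htx⟩
  -- The supremum need not lie in `T`; if `s` is a limit of `T` then `p s = s` and the gap is empty.
  set p : Ordinal.{u} → Ordinal.{u} := fun s => sSup {t ∈ T | t < s} with hp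
  have hbdd : ∀ s, BddAbove {t ∈ T | t < s} := fun s => ⟨s, fun t ht => ht.2.le⟩
  have hple : ∀ s, a < s → p s ≤ s := fun s hs => csSup_le (s := {t ∈ T | t < s}) ⟨a, Or.inl rfl, hs⟩ fun t ht => ht.2.le
  have hap : ∀ s, a < s → a ≤ p s := fun s hs => le_csSup (hbdd s) ⟨Or.inl rfl, hs⟩
  have htp : ∀ t ∈ T, ∀ s, t < s → t ≤ p s := fun t ht s hts => le_csSup (hbdd s) ⟨ht, hts⟩
  have hnext : ∀ c < b, ∃ s ∈ T, c ≤ s ∧ ∀ t ∈ T, t < s → t < c := by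
    intro c hc
    obtain ⟨s, ⟨hs, hcs⟩, hmin⟩ := exists_minimal_of_wellFoundedLT
      (fun t => t ∈ T ∧ c ≤ t) (hTcof c hc)
    refine ⟨s, hs, hcs, fun t ht hts => ?_⟩
    by_contra! h
    exact absurd (hmin ⟨ht, h⟩ hts.le) (not_le.2 hts)
  have hex : ∀ s, ∃ U, (s ∈ T ∧ a < s) → IsIntervalBasis (p s) s U := by
    intro s
    by_cases hs : s ∈ T ∧ a < s
    · obtain ⟨U, hU⟩ := ih s (hTb s hs.1) (p s) (hple s hs.2) ((hTb s hs.1).trans hb)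
      exact ⟨U, fun _ => hU⟩
    · exact ⟨∅, fun h => absurd h hs⟩
  choose V hV using hex
  refine ⟨(fun t => (t, b)) '' T ∪ ⋃ s ∈ {s ∈ T | a < s}, V s, ⟨?_, ?_, ?_, ?_⟩⟩
  · rintro q (⟨t, ht, rfl⟩ | hq)
    · exact ⟨hTa t ht, hTb t ht, le_rfl⟩
    · obtain ⟨s, hs, hq⟩ := mem_iUnion₂.1 hq
      obtain ⟨h1, h2, h3⟩ := (hV s hs).bounds q hq
      exact ⟨(hap s hs.2).trans h1, h2, h3.trans (hTb s hs.1).le⟩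
  · intro x hx
    have hfirst : {t ∈ T | t < x ∧ x ≤ b}.Countable := by
      rcases lt_trichotomy x b with h | rfl | h
      · exact (hTinit x h).mono (by rintro t ⟨h1, h2, -⟩; exact ⟨h1, h2⟩)
      · exact (hTcount hx).mono (sep_subset _ _)
      · refine Set.countable_empty.mono ?_
        rintro t ⟨-, -, h'⟩
        exact absurd h (not_lt.2 h')
    -- The gaps `(p s, s]` are pairwise disjoint, so `x` meets at most one of the inductively chosen
    -- families.
    have huniq : {s ∈ T | a < s ∧ p s < x ∧ x ≤ s}.Subsingleton := by
      rintro s ⟨hs, has, hps, hxs⟩ s' ⟨hs', has', hps', hxs'⟩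
      rcases lt_trichotomy s s' with h | h | h
      · exact absurd ((htp s hs s' h).trans_lt hps') (not_lt.2 hxs)
      · exact h
      · exact absurd ((htp s' hs' s h).trans_lt hps) (not_lt.2 hxs')
    refine ((hfirst.image fun t => (t, b)).union
      (huniq.countable.biUnion (t := fun s _ => {q ∈ V s | (s ∈ T ∧ a < s) ∧ q.1 < x ∧ x ≤ q.2})
        fun s hs => ((hV s ⟨hs.1, hs.2.1⟩).countable x hx).mono
          (by rintro q ⟨h1, -, h2⟩; exact ⟨h1, h2⟩))).mono ?_
    rintro q ⟨⟨t, ht, rfl⟩ | hq, h1, h2⟩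
    · exact Or.inl ⟨t, ⟨ht, h1, h2⟩, rfl⟩
    · obtain ⟨s, hs, hq⟩ := mem_iUnion₂.1 hq
      obtain ⟨h3, h4, h5⟩ := (hV s hs).bounds q hq
      exact Or.inr (mem_iUnion₂.2 ⟨s, ⟨hs.1, hs.2, h3.trans_lt h1, h2.trans h5⟩, hq, hs, h1, h2⟩)
  · intro x hx hax hxb c hcx hcount
    obtain rfl | hxb := hxb.eq_or_lt
    · have : {t ∈ T | c ≤ t}.Countable := by
        refine (hcount.image Prod.fst).mono ?_
        rintro t ⟨ht, hct⟩
        exact ⟨(t, x), ⟨Or.inl ⟨t, ht, rfl⟩, hct, rfl⟩, rfl⟩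
      obtain ⟨d, hd, hbound⟩ := Ordinal.exists_countable_bound hx this fun t ht => hTb t ht.1
      have hlim : Order.succ (max c d) < x :=
        (Ordinal.one_lt_cof_iff.1 (Cardinal.one_lt_aleph0.trans hx)).succ_lt (max_lt hcx hd)
      obtain ⟨t, ht, hle⟩ := hTcof _ hlim
      have h1 := Order.succ_le_iff.1 hle
      exact absurd (hbound t ⟨ht, (le_max_left c d).trans h1.le⟩)
        (not_le.2 ((le_max_right c d).trans_lt h1))
    · obtain ⟨s, hs, hxs, hmin⟩ := hnext x hxb
      have has : a < s := hax.trans_le hxs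
      -- Only countably many elements of `T` precede `s`, all below `x`; uncountable cofinality
      -- keeps their supremum strictly below `x`.
      have hpx : p s < x := by
        obtain ⟨d, hd, hbound⟩ := Ordinal.exists_countable_bound hx (hTinit x hxb) fun t ht => ht.2
        exact (csSup_le (s := {t ∈ T | t < s}) ⟨a, Or.inl rfl, has⟩ fun t ht =>
          hbound t ⟨ht.1, hmin t ht.1 ht.2⟩).trans_lt hd
      refine (hV s ⟨hs, has⟩).not_countable x hx hpx hxs c hcx (hcount.mono ?_)
      rintro q ⟨hq, h⟩
      exact ⟨Or.inr (mem_iUnion₂.2 ⟨s, ⟨hs, has⟩, hq⟩), h⟩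
  · intro c hac hcb
    obtain rfl | hcb := hcb.eq_or_lt
    · exact .refl _
    obtain ⟨s, hs, hcs, hmin⟩ := hnext c hcb
    refine .trans _ s _ ?_ (.rel _ _ (Or.inl ⟨s, hs, rfl⟩))
    obtain rfl | has := (hTa s hs).eq_or_lt
    · rw [le_antisymm hcs hac]
      exact .refl _
    · refine ((hV s ⟨hs, has⟩).connected c ?_ hcs).mono fun x y hxy =>
        Or.inr (mem_iUnion₂.2 ⟨s, ⟨hs, has⟩, hxy⟩)
      exact csSup_le (s := {t ∈ T | t < s}) ⟨a, Or.inl rfl, has⟩ fun t ht => (hmin t ht.1 ht.2).le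

end IntervalFamilies

/-! ### Atomic functionals and their norm -/

section AtomicFunctionals

variable {𝕜 : Type*} [RCLike 𝕜]

theorem summable_mul_continuousMap {K : Type*} [TopologicalSpace K] [CompactSpace K] {a : K → 𝕜}
    (ha : Summable fun x => ‖a x‖) (f : C(K, 𝕜)) : Summable fun x => ‖a x * f x‖ := by
  refine (ha.mul_right ‖f‖).of_nonneg_of_le (fun x => norm_nonneg _) fun x => ?_
  rw [norm_mul]
  exact mul_le_mul_of_nonneg_left (f.norm_coe_le_norm x) (norm_nonneg _)

/-- The functional `f ↦ ∑ a x * f x`. -/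
noncomputable def atomicFunctional {K : Type*} [TopologicalSpace K] [CompactSpace K] (a : K → 𝕜)
    (ha : Summable fun x => ‖a x‖) : StrongDual 𝕜 C(K, 𝕜) :=
  LinearMap.mkContinuous
    { toFun := fun f => ∑' x, a x * f x
      map_add' := fun f g => by
        simp only [ContinuousMap.add_apply, mul_add]
        exact (summable_mul_continuousMap ha f).of_norm.tsum_add
          (summable_mul_continuousMap ha g).of_norm
      map_smul' := fun c f => by
        simp only [ContinuousMap.smul_apply, smul_eq_mul, RingHom.id_apply, mul_left_comm,
          tsum_mul_left] }
    (∑' x, ‖a x‖) fun f => by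
      rw [← tsum_mul_right]
      refine tsum_of_norm_bounded (ha.mul_right ‖f‖).hasSum fun x => ?_
      rw [norm_mul]
      exact mul_le_mul_of_nonneg_left (f.norm_coe_le_norm x) (norm_nonneg _)

theorem atomicFunctional_apply {K : Type*} [TopologicalSpace K] [CompactSpace K] (a : K → 𝕜)
    (ha : Summable fun x => ‖a x‖) (f : C(K, 𝕜)) :
    atomicFunctional a ha f = ∑' x, a x * f x := rfl

/-- The `ℓ¹`-norm of the coefficients of an atomic functional is bounded by its norm. -/
theorem sum_norm_le_norm_atomicFunctional {K : Type*} [TopologicalSpace K] [CompactSpace K]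
    [T2Space K] (a : K → 𝕜) (ha : Summable fun x => ‖a x‖) (F : Finset K) :
    ∑ x ∈ F, ‖a x‖ ≤ ‖atomicFunctional a ha‖ := by
  classical
  refine le_of_forall_pos_le_add fun ε hε => ?_
  obtain ⟨F', hF'⟩ := ((Metric.tendsto_nhds.1 ha.hasSum) (ε / 2) (half_pos hε)).exists_forall_of_atTop
  set E := F ∪ F'
  have hE := hF' E Finset.subset_union_right
  rw [Real.dist_eq, abs_sub_comm] at hE
  have htail := ha.sum_add_tsum_compl (s := E)
  have htail' : ∑' x : ↑(E : Set K)ᶜ, ‖a x‖ < ε / 2 := by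
    have := (abs_lt.1 hE).2
    linarith
  have : DiscreteTopology (E : Set K) := inferInstance
  -- Tietze extension, within the unit ball, of the conjugate phase of `a` on `E`; where `a x = 0`
  -- the quotient is 0.
  obtain ⟨f, hf, hfE⟩ := ContinuousMap.exists_forall_mem_restrict_eq (Y := 𝕜)
    (t := Metric.closedBall (0 : 𝕜) 1) E.finite_toSet.isClosed
    (⟨fun x => (starRingEnd 𝕜) (a x) / ‖a x‖, continuous_of_discreteTopology⟩ :
      C((E : Set K), 𝕜)) (by
      intro x
      simp only [ContinuousMap.coe_mk, mem_closedBall_zero_iff, norm_div, RCLike.norm_conj,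
        RCLike.norm_ofReal, abs_norm]
      exact div_self_le_one _)
  have hfE' : ∀ x ∈ E, a x * f x = ‖a x‖ := by
    intro x hx
    have h : f x = (starRingEnd 𝕜) (a x) / ‖a x‖ := congrArg (fun g => g ⟨x, hx⟩) hfE
    by_cases h0 : a x = 0
    · simp [h0]
    · have h0' : (‖a x‖ : 𝕜) ≠ 0 := by simpa using h0
      rw [h, ← mul_div_assoc, RCLike.mul_conj, sq, mul_div_assoc, div_self h0', mul_one]
  have hf1 : ‖f‖ ≤ 1 := (ContinuousMap.norm_le _ zero_le_one).2 fun x => by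
    simpa using hf x
  have hsum := (summable_mul_continuousMap ha f).of_norm.sum_add_tsum_compl (s := E)
  have htailf : ‖∑' x : ↑(E : Set K)ᶜ, a x * f x‖ ≤ ∑' x : ↑(E : Set K)ᶜ, ‖a x‖ := by
    refine tsum_of_norm_bounded (ha.subtype _).hasSum fun x => ?_
    rw [norm_mul]
    exact mul_le_of_le_one_right (norm_nonneg _) ((f.norm_coe_le_norm x).trans hf1)
  have hmain : ‖∑ x ∈ E, a x * f x‖ = ∑ x ∈ E, ‖a x‖ := by
    rw [Finset.sum_congr rfl hfE', ← RCLike.ofReal_sum, RCLike.norm_ofReal, abs_of_nonneg]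
    exact Finset.sum_nonneg fun _ _ => norm_nonneg _
  have hφ : ‖∑' x, a x * f x‖ ≤ ‖atomicFunctional a ha‖ :=
    (atomicFunctional a ha).le_of_opNorm_le_of_le le_rfl hf1 |>.trans_eq (mul_one _)
  calc ∑ x ∈ F, ‖a x‖ ≤ ∑ x ∈ E, ‖a x‖ :=
        Finset.sum_le_sum_of_subset_of_nonneg Finset.subset_union_left fun _ _ _ => norm_nonneg _
    _ = ‖(∑' x, a x * f x) - ∑' x : ↑(E : Set K)ᶜ, a x * f x‖ := by
        rw [← hmain, ← hsum]; simp
    _ ≤ ‖atomicFunctional a ha‖ + ε := by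
        refine (norm_sub_le _ _).trans ?_
        linarith

end AtomicFunctionals

/-! ### Atomicity of all functionals -/

section Representation

variable {𝕜 : Type*} [RCLike 𝕜] {η : Ordinal.{u}}

variable (𝕜) in
/-- The indicator function of `[0, c]`. -/
noncomputable def iicIndicator (c : OrdinalSegment η) : C(OrdinalSegment η, 𝕜) :=
  1 - iocIndicator 𝕜 η c η

open Classical in
theorem iicIndicator_apply (c x : OrdinalSegment η) :
    iicIndicator 𝕜 c x = if x ≤ c then 1 else 0 := by
  have hx := x.2.2
  have h : x ≤ c ↔ (x : Ordinal) ≤ c := Iff.rfl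
  rw [iicIndicator, ContinuousMap.sub_apply, iocIndicator_apply, ContinuousMap.one_apply]
  by_cases hxc : x ≤ c
  · rw [if_pos hxc, if_neg (fun h' => not_lt.2 (h.1 hxc) h'.1), sub_zero]
  · rw [if_neg hxc, if_pos ⟨not_le.1 (fun h' => hxc (h.2 h')), hx⟩, sub_self]

theorem iicIndicator_eq_one {c : OrdinalSegment η} (hc : (c : Ordinal) = η) :
    iicIndicator 𝕜 c = 1 := by
  classical
  ext x
  have hx : x ≤ c := x.2.2.trans_eq hc.symm
  rw [iicIndicator_apply, if_pos hx, ContinuousMap.one_apply]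

theorem iicIndicator_mul (c d : OrdinalSegment η) :
    iicIndicator 𝕜 c * iicIndicator 𝕜 d = iicIndicator 𝕜 (min c d) := by
  classical
  ext x
  simp only [ContinuousMap.mul_apply, iicIndicator_apply, le_min_iff]
  grind

theorem norm_iicIndicator_mul_le (c : OrdinalSegment η) (f : C(OrdinalSegment η, 𝕜)) :
    ‖iicIndicator 𝕜 c * f‖ ≤ ‖f‖ := by
  classical
  refine (ContinuousMap.norm_le _ (norm_nonneg _)).2 fun x => ?_
  rw [ContinuousMap.mul_apply, iicIndicator_apply]
  split_ifs
  · simpa using f.norm_coe_le_norm x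
  · simp

theorem clm_ext_iicIndicator {φ ψ : StrongDual 𝕜 C(OrdinalSegment η, 𝕜)}
    (h : ∀ c : OrdinalSegment η, φ (iicIndicator 𝕜 c) = ψ (iicIndicator 𝕜 c)) : φ = ψ := by
  classical
  have h1 : φ 1 = ψ 1 := by
    rw [← iicIndicator_eq_one (c := ⟨η, zero_le, le_rfl⟩) rfl]
    exact h _
  refine clm_ext_iocIndicator 𝕜 h1 fun c => ?_
  by_cases hc : c ≤ η
  · have := h ⟨c, zero_le, hc⟩
    rw [iicIndicator, map_sub, map_sub, h1] at this
    exact sub_right_injective this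
  · have : iocIndicator 𝕜 η c η = 0 := by
      ext x
      have hx := x.2.2
      rw [iocIndicator_apply, if_neg (fun h' => hc (h'.1.le.trans h'.2)), ContinuousMap.zero_apply]
    rw [this, map_zero, map_zero]

/-- Every functional on `C([0, η])` is atomic. -/
theorem exists_eq_atomicFunctional (φ : StrongDual 𝕜 C(OrdinalSegment η, 𝕜)) :
    ∃ (a : OrdinalSegment η → 𝕜) (ha : Summable fun x => ‖a x‖), φ = atomicFunctional a ha := by
  classical
  -- Transfinite recursion: `a x` is what the earlier coefficients leave of the value at the
  -- indicator of `[0, x]`. Summability is proved only afterwards; until then the `tsum` may be its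
  -- default 0.
  obtain ⟨a, ha⟩ : ∃ a : OrdinalSegment η → 𝕜, ∀ x, a x =
      φ (iicIndicator 𝕜 x) - ∑' y : Iio x, a y :=
    ⟨IsWellFounded.fix (· < ·) fun x ih => φ (iicIndicator 𝕜 x) - ∑' y : Iio x, ih y y.2,
      fun x => IsWellFounded.fix_eq _ _ x⟩
  have hsum : ∀ x, Summable ((Iic x).indicator fun y => ‖a y‖) →
      φ (iicIndicator 𝕜 x) = ∑' y, (Iic x).indicator a y := by
    intro x hx
    have hx' : Summable ((Iio x).indicator a) := by
      refine (hx.indicator (Iio x)).of_norm_bounded fun y => ?_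
      simp only [indicator_apply, mem_Iio, mem_Iic]
      split_ifs with h1 h2
      · rfl
      · exact absurd h1.le h2
      · simp
    rw [← Iio_union_right, indicator_union_of_disjoint (by simp), hx'.tsum_add]
    · rw [← tsum_subtype, ← tsum_subtype, tsum_singleton, ha x]
      simp
    · exact summable_of_hasFiniteSupport ((finite_singleton x).subset support_indicator_subset)
  have hrep : ∀ β, ∀ h : Summable ((Iic β).indicator fun y => ‖a y‖), ∀ f,
      φ (iicIndicator 𝕜 β * f) = atomicFunctional ((Iic β).indicator a)
        (by simpa only [norm_indicator_eq_indicator_norm] using h) f := by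
    intro β h
    refine DFunLike.congr_fun (F := StrongDual 𝕜 C(OrdinalSegment η, 𝕜))
      (f := φ.comp (ContinuousLinearMap.mul 𝕜 C(OrdinalSegment η, 𝕜) (iicIndicator 𝕜 β))) ?_
    refine clm_ext_iicIndicator fun c => ?_
    rw [ContinuousLinearMap.comp_apply, ContinuousLinearMap.mul_apply', iicIndicator_mul,
      hsum, atomicFunctional_apply]
    · refine tsum_congr fun y => ?_
      simp only [indicator_apply, iicIndicator_apply, mem_Iic, le_min_iff]
      grind
    · refine (h.indicator (Iic (min β c))).congr fun y => ?_
      simp only [indicator_apply, mem_Iic, le_min_iff]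
      grind
  -- A finite `F` below `x` has a maximum `β < x`, where the atomic form is known by induction and
  -- has norm at most `‖φ‖`. This bound does not depend on `F`, so limit stages cause no loss.
  have hall : ∀ x, Summable ((Iic x).indicator fun y => ‖a y‖) := by
    intro x
    induction x using WellFoundedLT.induction with
    | ind x ih =>
    rw [← Iio_union_right, indicator_union_of_disjoint (by simp)]
    refine Summable.add ?_
      (summable_of_hasFiniteSupport ((finite_singleton x).subset support_indicator_subset))
    rw [← summable_subtype_iff_indicator]
    refine summable_of_sum_le (c := ‖φ‖) (fun _ => norm_nonneg _) fun F => ?_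
    obtain rfl | hF := F.eq_empty_or_nonempty
    · rw [Finset.sum_empty]
      exact norm_nonneg φ
    · set β := F.max' hF
      have hβ := ih β β.2
      have hnorm : ‖atomicFunctional ((Iic (β : OrdinalSegment η)).indicator a)
          (by simpa only [norm_indicator_eq_indicator_norm] using hβ)‖ ≤ ‖φ‖ := by
        refine ContinuousLinearMap.opNorm_le_bound _ (norm_nonneg φ) fun f => ?_
        rw [← hrep β hβ f]
        exact φ.le_of_opNorm_le_of_le le_rfl (norm_iicIndicator_mul_le _ f)
      refine le_trans (le_of_eq ?_) ((sum_norm_le_norm_atomicFunctional _ _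
        (F.map (Function.Embedding.subtype _))).trans hnorm)
      rw [Finset.sum_map]
      refine Finset.sum_congr rfl fun y hy => ?_
      have : (y : OrdinalSegment η) ≤ β := F.le_max' y hy
      simp [this]
  have htop := hall ⟨η, zero_le, le_rfl⟩
  have huniv : Iic (⟨η, zero_le, le_rfl⟩ : OrdinalSegment η) = univ :=
    eq_univ_of_forall fun x => x.2.2
  have hone : iicIndicator 𝕜 (⟨η, zero_le, le_rfl⟩ : OrdinalSegment η) = 1 :=
    iicIndicator_eq_one rfl
  have hr := hrep _ htop
  rw [huniv, indicator_univ] at htop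
  refine ⟨a, htop, ?_⟩
  ext f
  have := hr f
  rw [hone, one_mul] at this
  rw [this, atomicFunctional_apply, atomicFunctional_apply, huniv, indicator_univ]

end Representation

/-! ### Radon measures on ordinal segments -/

section AtomicMeasures

variable {𝕜 : Type*} [RCLike 𝕜]

theorem innerRegular_dirac {K : Type*} [TopologicalSpace K] [MeasurableSpace K] (x : K) :
    (Measure.dirac x).InnerRegular := by
  refine ⟨fun A hA r hr => ?_⟩
  rw [Measure.dirac_apply' x hA] at hr
  by_cases hx : x ∈ A
  · refine ⟨{x}, singleton_subset_iff.2 hx, isCompact_singleton, ?_⟩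
    rw [Measure.dirac_apply_of_mem (mem_singleton x)]
    simpa [hx] using hr
  · simp [hx] at hr

/-- The vector measure `A ↦ ∑ x ∈ A, a x`. -/
noncomputable def atomicMeasure {K : Type*} [MeasurableSpace K] (a : K → 𝕜)
    (ha : Summable fun x => ‖a x‖) : VectorMeasure K 𝕜 where
  measureOf' A := by
    classical
    exact if MeasurableSet A then ∑' x : A, a x else 0
  empty' := by simp
  not_measurable' A hA := if_neg hA
  m_iUnion' f hf hdisj := by
    classical
    have h : HasSum (fun x : ↥(⋃ i, f i) => a x) (∑' x : ↥(⋃ i, f i), a x) :=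
      (ha.of_norm.subtype _).hasSum
    rw [← (unionEqSigmaOfDisjoint hdisj).symm.hasSum_iff] at h
    simp only [hf, if_true, MeasurableSet.iUnion hf]
    refine h.sigma fun i => ?_
    have := (ha.of_norm.subtype (f i)).hasSum
    exact this

theorem atomicMeasure_apply {K : Type*} [MeasurableSpace K] (a : K → 𝕜)
    (ha : Summable fun x => ‖a x‖) {A : Set K} (hA : MeasurableSet A) :
    atomicMeasure a ha A = ∑' x : A, a x := if_pos hA

theorem atomicMeasure_singleton {K : Type*} [MeasurableSpace K] [MeasurableSingletonClass K]
    (a : K → 𝕜) (ha : Summable fun x => ‖a x‖) (x : K) : atomicMeasure a ha {x} = a x := by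
  rw [atomicMeasure_apply a ha (measurableSet_singleton x), tsum_singleton]

/-- One inequality is the triangle inequality for series; the other follows by adding the variations
of finitely many atoms in `A`. -/
theorem variation_atomicMeasure {K : Type*} [MeasurableSpace K] [MeasurableSingletonClass K]
    (a : K → 𝕜) (ha : Summable fun x => ‖a x‖) :
    (atomicMeasure a ha).variation = Measure.sum fun x => ‖a x‖ₑ • Measure.dirac x := by
  have hm : ∀ A, MeasurableSet A →
      (Measure.sum fun x => ‖a x‖ₑ • Measure.dirac x) A = ∑' x : A, ‖a x‖ₑ := by
    intro A hA
    rw [Measure.sum_apply _ hA, tsum_subtype A fun x => ‖a x‖ₑ]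
    refine tsum_congr fun x => ?_
    rw [Measure.smul_apply, Measure.dirac_apply' x hA]
    by_cases hx : x ∈ A <;> simp [hx]
  refine le_antisymm (VectorMeasure.variation_le_of_forall_enorm_le fun A hA => ?_)
    (Measure.le_intro fun A hA _ => ?_)
  · rw [hm A hA, atomicMeasure_apply a ha hA]
    exact enorm_tsum_le_tsum_enorm
  · rw [hm A hA, ENNReal.tsum_eq_iSup_sum]
    refine iSup_le fun F => ?_
    calc ∑ x ∈ F, ‖a x‖ₑ ≤ ∑ x ∈ F, (atomicMeasure a ha).variation {(x : K)} :=
          Finset.sum_le_sum fun x _ => by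
            rw [← atomicMeasure_singleton a ha x]
            exact VectorMeasure.enorm_measure_le_variation _ _
      _ = ∑ x ∈ F.map (Function.Embedding.subtype _), (atomicMeasure a ha).variation {x} := by
          rw [Finset.sum_map]
          rfl
      _ = (atomicMeasure a ha).variation (F.map (Function.Embedding.subtype _)) :=
          sum_measure_singleton
      _ ≤ (atomicMeasure a ha).variation A := measure_mono (by simp)

theorem isRadon_atomicMeasure {K : Type*} [TopologicalSpace K] [T2Space K] [MeasurableSpace K]
    [BorelSpace K] (a : K → 𝕜) (ha : Summable fun x => ‖a x‖) : IsRadon (atomicMeasure a ha) := by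
  have hfin : IsFiniteMeasure (atomicMeasure a ha).variation := by
    refine ⟨?_⟩
    rw [variation_atomicMeasure, Measure.sum_apply _ MeasurableSet.univ]
    simp only [Measure.smul_apply, measure_univ, smul_eq_mul, mul_one]
    have h : Summable fun x => ‖a x‖₊ := NNReal.summable_coe.1 ha
    exact (ENNReal.tsum_coe_ne_top_iff_summable.2 h).lt_top
  refine ⟨hfin, ?_⟩
  have : ∀ x, (Measure.dirac x : Measure K).InnerRegular := innerRegular_dirac
  have : (atomicMeasure a ha).variation.InnerRegular := by
    rw [variation_atomicMeasure]
    infer_instance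
  infer_instance

variable {η : Ordinal.{u}}

/-- A finite regular measure on `[0, η]` without atoms in `C` vanishes on `C`. -/
theorem measure_eq_zero_of_forall_singleton (ν : Measure (OrdinalSegment η)) [IsFiniteMeasure ν]
    [ν.Regular] {C : Set (OrdinalSegment η)} (hC : MeasurableSet C) (h : ∀ x ∈ C, ν {x} = 0) :
    ν C = 0 := by
  by_contra hne
  have huniv : Iic (⟨η, zero_le, le_rfl⟩ : OrdinalSegment η) = univ :=
    eq_univ_of_forall fun x => x.2.2
  -- At the least such `x` there is no atom in `C`, so the mass lies in `[0, x)`. A compact part of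
  -- positive mass has a maximum `y < x`, contradicting minimality.
  obtain ⟨x, hx, hmin⟩ := exists_minimal_of_wellFoundedLT (fun x => ν (C ∩ Iic x) ≠ 0)
    ⟨_, by rwa [huniv, inter_univ]⟩
  have hsing : ν (C ∩ {x}) = 0 := by
    by_cases hxC : x ∈ C
    · exact measure_mono_null inter_subset_right (h x hxC)
    · rw [inter_singleton_eq_empty.2 hxC, measure_empty]
  have hIio : ν (C ∩ Iio x) ≠ 0 := by
    intro h0
    rw [← Iio_union_right, inter_union_distrib_left] at hx
    exact hx (measure_union_null h0 hsing)
  obtain ⟨L, hLC, hL, hpos⟩ := (hC.inter measurableSet_Iio).exists_lt_isCompact_of_ne_top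
    (measure_ne_top ν _) (pos_iff_ne_zero.2 hIio)
  obtain ⟨y, hy⟩ := hL.exists_isGreatest (nonempty_of_measure_ne_zero hpos.ne')
  have hyx : y < x := (hLC hy.1).2
  refine absurd (hmin (y := y) ?_ hyx.le) (not_le.2 hyx)
  exact (hpos.trans_le (measure_mono (subset_inter (hLC.trans inter_subset_left) hy.2))).ne'

theorem countable_setOf_measure_singleton_ne_zero {K : Type*} [MeasurableSpace K]
    [MeasurableSingletonClass K] (ν : Measure K) [IsFiniteMeasure ν] :
    {x | ν {x} ≠ 0}.Countable := by
  refine Summable.countable_support_ennreal (f := fun x => ν {x}) ?_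
  refine ((tsum_meas_le_meas_iUnion_of_disjoint ν (fun x => measurableSet_singleton x)
    fun x y hxy => ?_).trans_lt (measure_lt_top ν _)).ne
  simpa using hxy

theorem hasSum_indicator_singleton {K E : Type*} [AddCommMonoid E] [TopologicalSpace E]
    (S : Set K) (g : K → E) (y : K) :
    HasSum (fun i : S => ({(i : K)} : Set K).indicator (fun _ => g i) y) (S.indicator g y) := by
  by_cases hy : y ∈ S
  · have := hasSum_single (f := fun i : S => ({(i : K)} : Set K).indicator (fun _ => g i) y) ⟨y, hy⟩
      fun i hi => indicator_of_notMem (fun h => hi (Subtype.ext (mem_singleton_iff.1 h).symm)) _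
    simpa [hy] using this
  · have : (fun i : S => ({(i : K)} : Set K).indicator (fun _ => g i) y) = 0 := by
      ext i
      exact indicator_of_notMem (fun h : y ∈ {(i : K)} => hy (mem_singleton_iff.1 h ▸ i.2)) _
    rw [this, indicator_of_notMem hy]
    exact hasSum_zero

/-- The integral against a Radon measure on `[0, η]` is determined by the atoms. -/
theorem IsRadon.integral_eq_tsum {μ : VectorMeasure (OrdinalSegment η) 𝕜} (h : IsRadon μ) :
    (Summable fun x => ‖μ {x}‖) ∧ ∀ f : C(OrdinalSegment η, 𝕜),
      μ.integral f (ContinuousLinearMap.mul ℝ 𝕜) = ∑' x, μ {x} * f x := by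
  obtain ⟨hfin, hreg⟩ := h
  set ν := μ.variation with hν
  set S : Set (OrdinalSegment η) := {x | ν {x} ≠ 0}
  have hS : S.Countable := countable_setOf_measure_singleton_ne_zero ν
  have hS' : Countable S := hS
  have hnull : ∀ᵐ x ∂ν, x ∈ S :=
    measure_eq_zero_of_forall_singleton ν hS.measurableSet.compl fun x hx => not_not.1 hx
  have hle : ∀ x, ‖μ {x}‖ ≤ (ν {x}).toReal := fun x =>
    VectorMeasure.norm_measure_le_variation (measure_ne_top ν _)
  have ha : Summable fun x => ‖μ {x}‖ := by
    refine (ENNReal.summable_toReal (f := fun x => ν {x}) ?_).of_nonneg_of_le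
      (fun _ => norm_nonneg _) hle
    refine ((tsum_meas_le_meas_iUnion_of_disjoint ν (fun x => measurableSet_singleton x)
      fun x y hxy => ?_).trans_lt (measure_lt_top ν _)).ne
    simpa using hxy
  refine ⟨ha, fun f => ?_⟩
  -- Almost everywhere `f` is the sum of its restrictions to the countably many atoms; dominated
  -- convergence applies with the bound `‖f‖` on `S`.
  have hsum : HasSum (fun i : S => μ.integral
      (({(i : OrdinalSegment η)} : Set (OrdinalSegment η)).indicator fun _ => f i)
      (ContinuousLinearMap.mul ℝ 𝕜)) (μ.integral f (ContinuousLinearMap.mul ℝ 𝕜)) := by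
    refine VectorMeasure.hasSum_integral_of_dominated_convergence
      (fun i : S => ({(i : OrdinalSegment η)} : Set (OrdinalSegment η)).indicator fun _ => ‖f‖)
      (fun i => (stronglyMeasurable_const.indicator
        (measurableSet_singleton _)).aestronglyMeasurable)
      (fun i => .of_forall fun y => ?_)
      (.of_forall fun y => (hasSum_indicator_singleton S (fun _ => ‖f‖) y).summable) ?_ ?_
    · rw [norm_indicator_eq_indicator_norm]
      exact indicator_le_indicator (f.norm_coe_le_norm _)
    · simp only [fun y => (hasSum_indicator_singleton S (fun _ => ‖f‖) y).tsum_eq]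
      exact (integrable_const _).indicator hS.measurableSet
    · filter_upwards [hnull] with y hy
      have := hasSum_indicator_singleton S f y
      rwa [indicator_of_mem hy] at this
  have hint : ∀ i : S, μ.integral
      (({(i : OrdinalSegment η)} : Set (OrdinalSegment η)).indicator fun _ => f i)
      (ContinuousLinearMap.mul ℝ 𝕜) = f i * μ {(i : OrdinalSegment η)} := fun i =>
    VectorMeasure.integral_indicator_const (B := ContinuousLinearMap.mul ℝ 𝕜) (f i)
      (measurableSet_singleton _)
  rw [← hsum.tsum_eq, tsum_congr hint,
    tsum_subtype S fun x => f x * μ {x}]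
  refine tsum_congr fun x => ?_
  by_cases hx : x ∈ S
  · rw [indicator_of_mem hx, mul_comm]
  · have : ‖μ {x}‖ ≤ 0 := by simpa [not_not.1 hx] using hle x
    rw [indicator_of_notMem hx, norm_le_zero_iff.1 this, zero_mul]

theorem Represents.eq_atomicFunctional {μ : VectorMeasure (OrdinalSegment η) 𝕜}
    {φ : StrongDual 𝕜 C(OrdinalSegment η, 𝕜)} (h : Represents μ φ) :
    φ = atomicFunctional (fun x => μ {x}) h.1.integral_eq_tsum.1 := by
  ext f
  rw [h.2 f, h.1.integral_eq_tsum.2 f, atomicFunctional_apply]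

theorem represents_atomicMeasure (a : OrdinalSegment η → 𝕜) (ha : Summable fun x => ‖a x‖) :
    Represents (atomicMeasure a ha) (atomicFunctional a ha) := by
  have hr := isRadon_atomicMeasure a ha
  refine ⟨hr, fun f => ?_⟩
  simp only [hr.integral_eq_tsum.2 f, atomicFunctional_apply, atomicMeasure_singleton]

/-- Membership in `D(η)` in terms of the coefficients of an atomic functional. -/
theorem mem_ordinalD_iff {φ : StrongDual 𝕜 C(OrdinalSegment η, 𝕜)} :
    φ ∈ ordinalD 𝕜 η ↔ ∃ (a : OrdinalSegment η → 𝕜) (ha : Summable fun x => ‖a x‖),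
      φ = atomicFunctional a ha ∧ ∀ x : OrdinalSegment η, ℵ₀ < (x : Ordinal.{u}).cof → a x = 0 := by
  constructor
  · rintro ⟨μ, hμ, h⟩
    exact ⟨_, _, hμ.eq_atomicFunctional, h⟩
  · rintro ⟨a, ha, rfl, h⟩
    refine ⟨_, represents_atomicMeasure a ha, fun x hx => ?_⟩
    rw [atomicMeasure_singleton, h x hx]

end AtomicMeasures

/-! ### Sufficiency of `η < ω_ 2` -/

section SigmaSubspace

variable {𝕜 : Type*} [RCLike 𝕜] {η : Ordinal.{u}}

theorem iocIndicator_eq_zero {c d : Ordinal.{u}} (h : d ≤ c) : iocIndicator 𝕜 η c d = 0 := by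
  classical
  ext x
  rw [iocIndicator_apply, if_neg (fun h' => not_lt.2 h (h'.1.trans_le h'.2)),
    ContinuousMap.zero_apply]

/-- The Σ-subspace condition counts functions, so uncountably many intervals must give uncountably
many indicators. -/
theorem iocIndicator_injOn (x : Ordinal.{u}) :
    InjOn (fun p : Ordinal.{u} × Ordinal.{u} => iocIndicator 𝕜 η p.1 p.2)
      {p | p.1 < p.2 ∧ p.2 = x ∧ x ≤ η} := by
  classical
  have key : ∀ c c' : Ordinal.{u}, c < c' → c' < x → x ≤ η →
      iocIndicator 𝕜 η c x ≠ iocIndicator 𝕜 η c' x := by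
    intro c c' hcc' hc' hx h
    have := DFunLike.congr_fun h (⟨c', zero_le, hc'.le.trans hx⟩ : OrdinalSegment η)
    simp [iocIndicator_apply, hcc', hc'.le] at this
  rintro ⟨c, d⟩ ⟨hc, rfl, hx⟩ ⟨c', d'⟩ ⟨hc', hd, -⟩ heq
  obtain rfl : d' = d := hd
  rcases lt_trichotomy c c' with h | rfl | h
  · exact absurd heq (key c c' h hc' hx)
  · rfl
  · exact absurd heq.symm (key c' c h hc hx)

/-- The coefficient at a limit point is detected by small intervals. -/
theorem exists_atomicFunctional_iocIndicator_ne_zero (a : OrdinalSegment η → 𝕜)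
    (ha : Summable fun x => ‖a x‖) (x : OrdinalSegment η) (hx : ℵ₀ < (x : Ordinal.{u}).cof)
    (hax : a x ≠ 0) :
    ∃ c < (x : Ordinal.{u}), ∀ d, c ≤ d → d < x →
      atomicFunctional a ha (iocIndicator 𝕜 η d x) ≠ 0 := by
  classical
  obtain ⟨F, hF⟩ :=
    ((Metric.tendsto_nhds.1 ha.hasSum) ‖a x‖ (norm_pos_iff.2 hax)).exists_forall_of_atTop
  set E := insert x F
  have hE := hF E (Finset.subset_insert _ _)
  rw [Real.dist_eq, abs_sub_comm] at hE
  have htail : ∑' y : ↑(E : Set (OrdinalSegment η))ᶜ, ‖a y‖ < ‖a x‖ := by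
    have := ha.sum_add_tsum_compl (s := E)
    have := (abs_lt.1 hE).2
    linarith
  -- Beyond `c` the interval `(d, x]` meets `E` only in `x`, and the tail off `E` is too small to
  -- cancel `a x`.
  obtain ⟨c, hc, hbound⟩ := Ordinal.exists_countable_bound hx
    (A := (↑) '' {y ∈ (E : Set (OrdinalSegment η)) | y < x})
    ((E.countable_toSet.mono (sep_subset _ _)).image _) (by
      rintro _ ⟨y, hy, rfl⟩
      exact hy.2)
  refine ⟨c, hc, fun d hcd hdx h0 => ?_⟩
  have hsum := (summable_mul_continuousMap ha
    (iocIndicator 𝕜 η d x)).of_norm.sum_add_tsum_compl (s := E)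
  have hfin : ∑ y ∈ E, a y * iocIndicator 𝕜 η d x y = a x := by
    rw [Finset.sum_eq_single_of_mem x (Finset.mem_insert_self _ _)]
    · simp [iocIndicator_apply, hdx]
    · intro y hy hyx
      rw [iocIndicator_apply, if_neg, mul_zero]
      rintro ⟨h1, h2⟩
      have hlt : y < x := lt_of_le_of_ne h2 hyx
      exact not_lt.2 ((hbound y ⟨y, ⟨hy, hlt⟩, rfl⟩).trans hcd) h1
  have htail' : ‖∑' y : ↑(E : Set (OrdinalSegment η))ᶜ, a y * iocIndicator 𝕜 η d x y‖ ≤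
      ∑' y : ↑(E : Set (OrdinalSegment η))ᶜ, ‖a y‖ := by
    refine tsum_of_norm_bounded (ha.subtype _).hasSum fun y => ?_
    rw [norm_mul]
    exact mul_le_of_le_one_right (norm_nonneg _) (norm_iocIndicator_apply_le 𝕜 η d x y)
  rw [atomicFunctional_apply] at h0
  rw [hfin, h0, add_eq_zero_iff_eq_neg] at hsum
  rw [hsum, norm_neg] at htail
  exact absurd htail' (not_le.2 htail)

/-- `D(η)` is a Σ-subspace for `η < ω₂`. -/
theorem isSigmaSubspace_ordinalD (hη : η < ω_ 2) : IsSigmaSubspace (ordinalD 𝕜 η) := by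
  classical
  obtain ⟨U, hU⟩ := exists_isIntervalBasis η 0 zero_le hη
  set M : Set C(OrdinalSegment η, 𝕜) :=
    insert 1 ((fun p => iocIndicator 𝕜 η p.1 p.2) '' U) with hM
  refine ⟨M, ?_, ?_⟩
  · refine top_le_iff.1 ((span_iocIndicator_dense 𝕜 η).ge.trans
      (Submodule.topologicalClosure_mono (Submodule.span_le.2 ?_)))
    -- Indicators telescope along chains of intervals; a chain from `c` to `η` yields the indicator
    -- of `(c, η]`, as that of `(η, η]` is 0.
    have hrel : ∀ c d, Relation.EqvGen (fun c d => (c, d) ∈ U) c d →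
        iocIndicator 𝕜 η c η - iocIndicator 𝕜 η d η ∈ Submodule.span 𝕜 M := by
      intro c d h
      induction h with
      | rel c d h =>
        rw [← iocIndicator_eq_sub 𝕜 (hU.bounds _ h).2.1.le]
        exact Submodule.subset_span (Or.inr ⟨(c, d), h, rfl⟩)
      | refl c => simp
      | symm c d _ h => rw [← neg_sub]; exact Submodule.neg_mem _ h
      | trans c d e _ _ h1 h2 => simpa using Submodule.add_mem _ h1 h2
    rintro _ (rfl | ⟨c, rfl⟩)
    · exact Submodule.subset_span (Or.inl rfl)
    · by_cases hc : c ≤ η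
      · have := hrel c η (hU.connected c zero_le hc)
        rwa [iocIndicator_eq_zero le_rfl, sub_zero] at this
      · change iocIndicator 𝕜 η c η ∈ _
        rw [iocIndicator_eq_zero (not_le.1 hc).le]
        exact Submodule.zero_mem _
  · ext φ
    obtain ⟨a, ha, rfl⟩ := exists_eq_atomicFunctional φ
    change _ ↔ {f ∈ M | atomicFunctional a ha f ≠ 0}.Countable
    constructor
    · intro h
      obtain ⟨b, hb, hab, hb0⟩ := mem_ordinalD_iff.1 h
      rw [hab]
      have hcount : (Function.support b).Countable := by
        simpa [Function.support] using hb.countable_support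
      have hbig : (⋃ x ∈ Function.support b, (fun p => iocIndicator 𝕜 η p.1 p.2) ''
          {p ∈ U | p.1 < (x : Ordinal.{u}) ∧ (x : Ordinal.{u}) ≤ p.2}).Countable :=
        hcount.biUnion fun x hx =>
          (hU.countable x (not_lt.1 fun h => hx (hb0 x h))).image _
      refine (hbig.insert 1).mono ?_
      rintro f ⟨rfl | ⟨p, hp, rfl⟩, hf⟩
      · exact Or.inl rfl
      · right
        rw [atomicFunctional_apply] at hf
        obtain ⟨x, hx⟩ : ∃ x, b x * iocIndicator 𝕜 η p.1 p.2 x ≠ 0 := by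
          by_contra! h
          exact hf (by simp [h])
        refine mem_iUnion₂.2 ⟨x, left_ne_zero_of_mul hx, p, ⟨hp, ?_⟩, rfl⟩
        by_contra h
        exact hx (by rw [iocIndicator_apply, if_neg h, mul_zero])
    · intro h
      refine mem_ordinalD_iff.2 ⟨a, ha, rfl, fun x hx => ?_⟩
      by_contra hax
      obtain ⟨c, hc, hne⟩ := exists_atomicFunctional_iocIndicator_ne_zero a ha x hx hax
      have hx0 : 0 < (x : Ordinal.{u}) := zero_le.trans_lt hc
      -- Detection is guaranteed only for left ends at or beyond `c`, hence the lower bound on left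
      -- ends in `not_countable`.
      refine hU.not_countable x hx hx0 x.2.2 c hc ?_
      refine countable_of_injective_of_countable_image
        (f := fun p : Ordinal.{u} × Ordinal.{u} => iocIndicator 𝕜 η p.1 p.2)
        ((iocIndicator_injOn (x : Ordinal.{u})).mono ?_) (h.mono ?_)
      · rintro p ⟨hp, -, hpx⟩
        exact ⟨(hU.bounds p hp).2.1, hpx, x.2.2⟩
      · rintro _ ⟨⟨d, e⟩, ⟨hp, hcp, hpx⟩, rfl⟩
        obtain rfl : e = x := hpx
        exact ⟨Or.inr ⟨_, hp, rfl⟩, hne d hcp (hU.bounds _ hp).2.1⟩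

end SigmaSubspace

/-! ### `D(η)` is 1-norming -/

section OneNorming

variable {𝕜 : Type*} [RCLike 𝕜] {η : Ordinal.{u}}

theorem exists_forall_Ioc_mem_of_mem_nhds {x : OrdinalSegment η} (hx : 0 < (x : Ordinal.{u}))
    {V : Set (OrdinalSegment η)} (hV : V ∈ 𝓝 x) :
    ∃ c < (x : Ordinal.{u}), ∀ y : OrdinalSegment η, c < y → y ≤ x → y ∈ V := by
  obtain ⟨c, hc, h⟩ := exists_Ioc_subset_of_mem_nhds hV
    ⟨(⟨0, le_rfl, zero_le⟩ : OrdinalSegment η), hx⟩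
  exact ⟨c, hc, fun y h1 h2 => h ⟨h1, h2⟩⟩

/-- Points of uncountable cofinality are limits of successors, which have cofinality 1. -/
theorem dense_cof_le_aleph0 (η : Ordinal.{u}) :
    Dense {x : OrdinalSegment η | (x : Ordinal.{u}).cof ≤ ℵ₀} := by
  intro x
  rw [mem_closure_iff_nhds]
  intro V hV
  by_cases hx : (x : Ordinal.{u}).cof ≤ ℵ₀
  · exact ⟨x, mem_of_mem_nhds hV, hx⟩
  · have hlim := Ordinal.one_lt_cof_iff.1 (Cardinal.one_lt_aleph0.trans (not_le.1 hx))
    obtain ⟨c, hc, h⟩ := exists_forall_Ioc_mem_of_mem_nhds hlim.bot_lt hV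
    have hcx := hlim.succ_lt hc
    refine ⟨⟨Order.succ c, zero_le, hcx.le.trans x.2.2⟩, h _ (Order.lt_succ c) hcx.le, ?_⟩
    change (Order.succ c).cof ≤ ℵ₀
    rw [Order.succ_eq_add_one, Ordinal.cof_add_one]
    exact Cardinal.one_le_aleph0

theorem isOneNorming_ordinalD : IsOneNorming (ordinalD 𝕜 η) := by
  classical
  intro f
  constructor
  · rintro _ ⟨φ, ⟨-, hφ⟩, rfl⟩
    exact (φ.le_of_opNorm_le hφ f).trans_eq (one_mul _)
  · intro B hB
    have hB0 : 0 ≤ B := by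
      refine hB ⟨0, ⟨mem_ordinalD_iff.2 ⟨0, by simp [summable_zero], ?_, fun _ _ => rfl⟩, ?_⟩, ?_⟩
      · ext f
        simp [atomicFunctional_apply]
      · simp
      · simp
    refine (ContinuousMap.norm_le _ hB0).2 fun x => ?_
    have hclosed : IsClosed {x | ‖f x‖ ≤ B} := isClosed_le (by fun_prop) continuous_const
    refine hclosed.closure_subset_iff.2 ?_ (dense_cof_le_aleph0 η x)
    intro y hy
    refine hB ⟨ContinuousMap.evalCLM 𝕜 y, ⟨mem_ordinalD_iff.2 ⟨Pi.single y 1, ?_, ?_, ?_⟩, ?_⟩, rfl⟩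
    · refine summable_of_hasFiniteSupport ((finite_singleton y).subset fun z hz => ?_)
      by_contra h
      exact hz (by simp [Pi.single_eq_of_ne (mem_singleton_iff.not.1 h)])
    · ext g
      rw [atomicFunctional_apply, tsum_eq_single y fun z hz => by simp [Pi.single_eq_of_ne hz]]
      simp
    · intro z hz
      refine Pi.single_eq_of_ne ?_ _
      rintro rfl
      exact not_le.2 hz hy
    · refine ContinuousLinearMap.opNorm_le_bound _ zero_le_one fun g => ?_
      rw [one_mul]
      exact g.norm_coe_le_norm y

end OneNorming

/-! ### Evaluations and 1-norming Σ-subspaces -/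

section OneNormingSigma

variable {𝕜 : Type*} [RCLike 𝕜]

/-- A one-norming Σ-subspace contains the evaluations at isolated points. -/
theorem IsOneNorming.countable_of_isolated {K : Type*} [TopologicalSpace K] [CompactSpace K]
    {M : Set C(K, 𝕜)} (hM : IsOneNorming (sigmaSubspace 𝕜 M : Set (StrongDual 𝕜 C(K, 𝕜)))) (x : K)
    (e : C(K, 𝕜)) (hex : e x = 1) (he : ∀ y ≠ x, e y = 0) : {f ∈ M | f x ≠ 0}.Countable := by
  have hnorm : ‖e‖ = 1 := by
    refine le_antisymm ((ContinuousMap.norm_le _ zero_le_one).2 fun y => ?_) ?_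
    · by_cases hy : y = x
      · simp [hy, hex]
      · simp [he y hy]
    · simpa [hex] using e.norm_coe_le_norm x
  have hex : ∀ n : ℕ, ∃ φ ∈ sigmaSubspace 𝕜 M, ‖φ‖ ≤ 1 ∧ 1 - 1 / ((n : ℝ) + 1) < ‖φ e‖ := by
    intro n
    have hlt : 1 - 1 / ((n : ℝ) + 1) < ‖e‖ := by
      rw [hnorm]
      have : 0 < 1 / ((n : ℝ) + 1) := by positivity
      linarith
    obtain ⟨_, ⟨φ, ⟨h1, h2⟩, rfl⟩, h, -⟩ := (hM e).exists_between hlt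
    exact ⟨φ, h1, h2, h⟩
  choose φ hφM hφ1 hφ using hex
  refine (countable_iUnion fun n => hφM n).mono ?_
  rintro f ⟨hfM, hfx⟩
  rw [mem_iUnion]
  by_contra! h
  have h0 : ∀ n, φ n f = 0 := fun n => by
    by_contra h'
    exact h n ⟨hfM, h'⟩
  have hpos : 0 < ‖f x‖ := norm_pos_iff.2 hfx
  -- With this `t`, `f + t • e` takes at `x` a value of modulus `‖f‖` opposite to `f x`, so its norm
  -- does not exceed `‖f‖`. But `φ n` kills `f` and nearly norms `e`, forcing `‖f x‖ + ‖f‖ ≤ ‖f‖` in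
  -- the limit.
  set t : 𝕜 := -(1 + ((‖f‖ / ‖f x‖ : ℝ) : 𝕜)) * f x with ht
  have htn : ‖t‖ = ‖f x‖ + ‖f‖ := by
    have : (1 : 𝕜) + ((‖f‖ / ‖f x‖ : ℝ) : 𝕜) = ((1 + ‖f‖ / ‖f x‖ : ℝ) : 𝕜) := by push_cast; rfl
    rw [ht, this, norm_mul, norm_neg, RCLike.norm_ofReal, abs_of_nonneg (by positivity)]
    field_simp
  have hg : ‖f + t • e‖ ≤ ‖f‖ := by
    refine (ContinuousMap.norm_le _ (norm_nonneg f)).2 fun y => ?_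
    rw [ContinuousMap.add_apply, ContinuousMap.smul_apply]
    by_cases hy : y = x
    · have : f x + t • e x = -((‖f‖ / ‖f x‖ : ℝ) : 𝕜) * f x := by
        rw [‹e x = 1›, ht, smul_eq_mul]
        ring
      rw [hy, this, norm_mul, norm_neg, RCLike.norm_ofReal, abs_of_nonneg (by positivity),
        div_mul_cancel₀ _ hpos.ne']
    · simpa [he y hy] using f.norm_coe_le_norm y
  have hbound : ∀ n : ℕ, (‖f x‖ + ‖f‖) * (1 - 1 / ((n : ℝ) + 1)) ≤ ‖f‖ := by
    intro n
    calc (‖f x‖ + ‖f‖) * (1 - 1 / ((n : ℝ) + 1)) ≤ ‖t‖ * ‖φ n e‖ := by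
          rw [htn]
          exact mul_le_mul_of_nonneg_left (hφ n).le (by positivity)
      _ = ‖φ n (f + t • e)‖ := by rw [map_add, map_smul, h0, zero_add, norm_smul]
      _ ≤ 1 * ‖f + t • e‖ := (φ n).le_of_opNorm_le (hφ1 n) _
      _ ≤ ‖f‖ := by rwa [one_mul]
  have hlim : Tendsto (fun n : ℕ => (‖f x‖ + ‖f‖) * (1 - 1 / ((n : ℝ) + 1))) atTop
      (𝓝 ((‖f x‖ + ‖f‖) * (1 - 0))) :=
    (tendsto_const_nhds.sub tendsto_one_div_add_atTop_nhds_zero_nat).const_mul _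
  have := le_of_tendsto' hlim hbound
  linarith

variable {η : Ordinal.{u}}

theorem IsOneNorming.countable_of_succ {M : Set C(OrdinalSegment η, 𝕜)}
    (hM : IsOneNorming (sigmaSubspace 𝕜 M : Set (StrongDual 𝕜 C(OrdinalSegment η, 𝕜))))
    (x : OrdinalSegment η) (c : Ordinal.{u}) (hx : (x : Ordinal.{u}) = c + 1) :
    {f ∈ M | f x ≠ 0}.Countable := by
  classical
  refine hM.countable_of_isolated x (iocIndicator 𝕜 η c x) ?_ fun y hy => ?_
  · rw [iocIndicator_apply, if_pos ⟨hx ▸ lt_add_one c, le_rfl⟩]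
  · rw [iocIndicator_apply, if_neg]
    rintro ⟨h1, h2⟩
    refine hy (Subtype.ext (le_antisymm h2 ?_))
    rw [hx]
    exact Order.add_one_le_of_lt h1

/-- Continuous functions are constant near points of uncountable cofinality. -/
theorem exists_forall_eq_of_aleph0_lt_cof {x : OrdinalSegment η} (hx : ℵ₀ < (x : Ordinal.{u}).cof)
    (f : C(OrdinalSegment η, 𝕜)) :
    ∃ c < (x : Ordinal.{u}), ∀ y : OrdinalSegment η, c < y → y ≤ x → f y = f x := by
  have hx0 : 0 < (x : Ordinal.{u}) :=
    (Ordinal.one_lt_cof_iff.1 (Cardinal.one_lt_aleph0.trans hx)).bot_lt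
  have h : ∀ n : ℕ, ∃ c < (x : Ordinal.{u}), ∀ y : OrdinalSegment η, c < y → y ≤ x →
      y ∈ f ⁻¹' Metric.ball (f x) (1 / ((n : ℝ) + 1)) := fun n =>
    exists_forall_Ioc_mem_of_mem_nhds hx0
      (f.continuous.continuousAt (Metric.ball_mem_nhds _ (by positivity)))
  choose c hc hcf using h
  obtain ⟨d, hd, hcd⟩ := Ordinal.exists_countable_bound hx (countable_range c)
    (by rintro _ ⟨n, rfl⟩; exact hc n)
  refine ⟨d, hd, fun y hdy hyx => dist_le_zero.1 ?_⟩
  refine ge_of_tendsto' tendsto_one_div_add_atTop_nhds_zero_nat fun n => ?_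
  exact (Metric.mem_ball.1 (hcf n y ((hcd _ ⟨n, rfl⟩).trans_lt hdy) hyx)).le

theorem exists_forall_mem_eq_of_countable {x : OrdinalSegment η} (hx : ℵ₀ < (x : Ordinal.{u}).cof)
    {N : Set C(OrdinalSegment η, 𝕜)} (hN : N.Countable) :
    ∃ c < (x : Ordinal.{u}), ∀ f ∈ N, ∀ y : OrdinalSegment η, c < y → y ≤ x → f y = f x := by
  choose c hc hcf using fun f : C(OrdinalSegment η, 𝕜) => exists_forall_eq_of_aleph0_lt_cof hx f
  obtain ⟨d, hd, hcd⟩ := Ordinal.exists_countable_bound hx (hN.image c)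
    (by rintro _ ⟨f, -, rfl⟩; exact hc f)
  exact ⟨d, hd, fun f hf y hdy hyx => hcf f y ((hcd _ ⟨f, hf, rfl⟩).trans_lt hdy) hyx⟩

theorem eq_of_forall_mem_eq {K : Type*} [TopologicalSpace K] [CompactSpace K] {M : Set C(K, 𝕜)}
    (hM : (Submodule.span 𝕜 M).topologicalClosure = ⊤) {x y : K} (h : ∀ f ∈ M, f x = f y)
    (f : C(K, 𝕜)) : f x = f y := by
  have : ContinuousMap.evalCLM 𝕜 x = ContinuousMap.evalCLM 𝕜 y :=
    ContinuousLinearMap.ext_on (Submodule.dense_iff_topologicalClosure_eq_top.2 hM) h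
  exact DFunLike.congr_fun this f

/-- The evaluation at a point of uncountable cofinality does not belong to a one-norming
Σ-subspace. -/
theorem IsOneNorming.not_countable_of_aleph0_lt_cof {M : Set C(OrdinalSegment η, 𝕜)}
    (hM : IsOneNorming (sigmaSubspace 𝕜 M : Set (StrongDual 𝕜 C(OrdinalSegment η, 𝕜))))
    (hdense : (Submodule.span 𝕜 M).topologicalClosure = ⊤) {x : OrdinalSegment η}
    (hx : ℵ₀ < (x : Ordinal.{u}).cof) : ¬ {f ∈ M | f x ≠ 0}.Countable := by
  classical
  intro hcount
  have hlim := Ordinal.one_lt_cof_iff.1 (Cardinal.one_lt_aleph0.trans hx)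
  obtain ⟨γ, hγ, hconst⟩ := exists_forall_mem_eq_of_countable hx hcount
  have hstep : ∀ c : Iio (x : Ordinal.{u}), ∃ d : Iio (x : Ordinal.{u}), c < d ∧
      ∀ f ∈ M, ∀ z : OrdinalSegment η, (z : Ordinal.{u}) = c + 1 → f z ≠ 0 →
        ∀ y : OrdinalSegment η, d < (y : Ordinal.{u}) → y ≤ x → f y = f x := by
    rintro ⟨c, hc⟩
    have hc1 : c + 1 < x := hlim.add_one_lt hc
    obtain ⟨d, hd, hdf⟩ := exists_forall_mem_eq_of_countable hx
      (hM.countable_of_succ ⟨c + 1, zero_le, hc1.le.trans x.2.2⟩ c rfl)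
    refine ⟨⟨max d (c + 1), max_lt hd hc1⟩,
      show c < max d (c + 1) from (lt_add_one c).trans_le (le_max_right d (c + 1)), ?_⟩
    rintro f hf z hz hfz y hy hyx
    obtain rfl : z = ⟨c + 1, zero_le, hc1.le.trans x.2.2⟩ := Subtype.ext hz
    exact hdf f ⟨hf, hfz⟩ y ((le_max_left _ _).trans_lt hy) hyx
  choose d hd hdf using hstep
  let s : ℕ → Iio (x : Ordinal.{u}) := fun n => d^[n] ⟨γ, hγ⟩
  have hs : ∀ n, s (n + 1) = d (s n) := fun n => Function.iterate_succ_apply' d n _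
  have hslt : ∀ n, (s n : Ordinal.{u}) < s (n + 1) := fun n => by
    rw [hs]
    exact hd _
  obtain ⟨b, hb, hsb⟩ := Ordinal.exists_countable_bound hx
    (countable_range fun n => (s n : Ordinal.{u})) (by rintro _ ⟨n, rfl⟩; exact (s n).2)
  have hbdd : BddAbove (range fun n => (s n : Ordinal.{u})) := ⟨b, hsb⟩
  -- No `f ∈ M` separates `σ` from `x`: if `f x ≠ 0`, use `γ`; if `f` is nonzero at some `s n + 1`,
  -- use `d`; otherwise `f` vanishes at the points `s n + 1`, which tend to `σ`, and so at `σ`.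
  set σ := ⨆ n, (s n : Ordinal.{u}) with hσ
  have hσx : σ < x := (ciSup_le fun n => hsb _ ⟨n, rfl⟩).trans_lt hb
  have hsσ : ∀ n, (s n : Ordinal.{u}) < σ := fun n => (hslt n).trans_le (le_ciSup hbdd (n + 1))
  let y : OrdinalSegment η := ⟨σ, zero_le, hσx.le.trans x.2.2⟩
  have hyx : y ≤ x := hσx.le
  have heq : ∀ f ∈ M, f y = f x := by
    intro f hf
    by_cases hfx : f x = 0
    · by_cases hex : ∃ n, ∃ z : OrdinalSegment η, (z : Ordinal.{u}) = s n + 1 ∧ f z ≠ 0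
      · obtain ⟨n, z, hz, hfz⟩ := hex
        refine hdf (s n) f hf z hz hfz y ?_ hyx
        rw [← hs]
        exact hsσ _
      · push Not at hex
        rw [hfx]
        by_contra hfy
        obtain ⟨c, hc, hcf⟩ := exists_forall_Ioc_mem_of_mem_nhds (x := y)
          (zero_le.trans_lt (hsσ 0)) (f.continuous.continuousAt (isOpen_ne.mem_nhds hfy))
        obtain ⟨n, hn⟩ := exists_lt_of_lt_ciSup hc
        have hle : (s n : Ordinal.{u}) + 1 ≤ σ := Order.add_one_le_of_lt (hsσ n)
        refine hcf ⟨s n + 1, zero_le, hle.trans y.2.2⟩ (hn.trans (lt_add_one _)) hle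
          (hex n _ rfl)
    · exact hconst f ⟨hf, hfx⟩ y (hsσ 0) hyx
  have := eq_of_forall_mem_eq hdense heq (iocIndicator 𝕜 η σ x)
  rw [iocIndicator_apply, iocIndicator_apply, if_neg (fun h => lt_irrefl _ h.1),
    if_pos ⟨hσx, le_rfl⟩] at this
  exact zero_ne_one this

end OneNormingSigma

/-! ### Closing off below `ω_ 2` -/

section Closure

theorem Ordinal.cof_omega_two : (ω_ 2 : Ordinal.{u}).cof = ℵ_ 2 := by
  rw [← one_add_one_eq_two, Cardinal.cof_omega_add_one]

/-- A function on `ω₂` has a closure point of uncountable cofinality. -/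
theorem Ordinal.exists_closed_point_aleph0_lt_cof (d : Ordinal.{u} → Ordinal.{u})
    (hd : ∀ c < ω_ 2, d c < ω_ 2) : ∃ δ < ω_ 2, ℵ₀ < δ.cof ∧ ∀ c < δ, d c < δ := by
  have hbig : ∀ b : Ordinal.{u}, b < ω_ 2 → ∀ f : Iio b → Ordinal.{u}, (∀ i, f i < ω_ 2) →
      ⨆ i, f i + 1 < ω_ 2 := by
    intro b hb f hf
    refine Ordinal.lift_iSup_add_one_lt_of_lt_cof ?_ hf
    rw [← Ordinal.lift_cof, Ordinal.cof_omega_two]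
    have : b.card < ℵ_ 2 := by
      rw [← Cardinal.lt_ord]
      simpa using hb
    rw [Cardinal.mk_Iio_ordinal, Cardinal.lift_lift, Cardinal.lift_lt]
    exact this
  -- `G c` is at least `c` and exceeds `d` on all of `[0, c]`. Iterating `G` strictly increasingly
  -- `ω_ 1` times gives a closure point of cofinality `ℵ_ 1`.
  let G : Ordinal.{u} → Ordinal.{u} := fun c => max c (⨆ i : Iio (c + 1), d i + 1)
  have hG : ∀ c < ω_ 2, G c < ω_ 2 := by
    intro c hc
    have hc1 : c + 1 < ω_ 2 := (Cardinal.isSuccLimit_omega 2).add_one_lt hc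
    exact max_lt hc (hbig _ hc1 _ fun i => hd _ ((mem_Iio.1 i.2).trans hc1))
  have hGd : ∀ c c', c' ≤ c → d c' < G c := fun c c' h =>
    ((lt_add_one _).trans_le (le_ciSup (f := fun i : Iio (c + 1) => d i + 1)
      bddAbove_of_small ⟨c', Order.lt_add_one_iff.2 h⟩)).trans_le (le_max_right _ _)
  obtain ⟨h, hh⟩ : ∃ h : Ordinal.{u} → Ordinal.{u}, ∀ ξ, h ξ = ⨆ i : Iio ξ, G (h i) + 1 :=
    ⟨IsWellFounded.fix (· < ·) fun ξ ih => ⨆ i : Iio ξ, G (ih i i.2) + 1,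
      fun ξ => IsWellFounded.fix_eq _ _ ξ⟩
  have hlt : ∀ ζ ξ, ζ < ξ → G (h ζ) < h ξ := fun ζ ξ hζ => by
    rw [hh ξ]
    exact (lt_add_one _).trans_le
      (le_ciSup (f := fun i : Iio ξ => G (h i) + 1) bddAbove_of_small ⟨ζ, hζ⟩)
  have h12 : (ω_ 1 : Ordinal.{u}) < ω_ 2 := Ordinal.omega_lt_omega.2 one_lt_two
  have hh2 : ∀ ξ, ξ < ω_ 2 → h ξ < ω_ 2 := by
    intro ξ
    induction ξ using WellFoundedLT.induction with
    | ind ξ ih =>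
    intro hξ
    rw [hh ξ]
    exact hbig _ hξ _ fun i => hG _ (ih i i.2 ((mem_Iio.1 i.2).trans hξ))
  refine ⟨h (ω_ 1), hh2 _ h12, ?_, fun c hc => ?_⟩
  · rw [hh, Ordinal.cof_iSup_Iio_add_one (f := fun i : Iio (ω_ 1) => G (h i)), Cardinal.cof_omega_one]
    · exact Cardinal.aleph0_lt_aleph_one
    · intro i j hij
      exact (hlt i j hij).trans_le (le_max_left _ _)
  · rw [hh, Ordinal.lt_iSup_iff] at hc
    obtain ⟨⟨ζ, hζ⟩, hc⟩ := hc
    have hζ1 : ζ + 1 < ω_ 1 := (Cardinal.isSuccLimit_omega 1).add_one_lt hζ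
    have hle : c ≤ h (ζ + 1) :=
      (Order.lt_add_one_iff.1 hc).trans (hlt _ _ (lt_add_one ζ)).le
    exact (hGd _ c hle).trans (hlt _ _ hζ1)

end Closure

/-! ### Necessity of `η < ω_ 2` -/

section Main

variable {𝕜 : Type*} [RCLike 𝕜] {η : Ordinal.{u}}

theorem IsOnePlichko.lt_omega_two (h : IsOnePlichko 𝕜 C(OrdinalSegment η, 𝕜)) : η < ω_ 2 := by
  classical
  obtain ⟨_, ⟨M, hdense, rfl⟩, hM⟩ := h
  by_contra! hη
  let p : OrdinalSegment η := ⟨ω_ 2, zero_le, hη⟩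
  have hp : ℵ₀ < (p : Ordinal.{u}).cof := by
    change ℵ₀ < (ω_ 2 : Ordinal.{u}).cof
    rw [Ordinal.cof_omega_two, Cardinal.aleph0_lt_aleph]
    exact zero_lt_two
  have hlim := Cardinal.isSuccLimit_omega.{u} 2
  have hstep : ∀ c : Ordinal.{u}, ∃ d, c < ω_ 2 → d < ω_ 2 ∧
      ∀ f ∈ M, ∀ z : OrdinalSegment η, (z : Ordinal.{u}) = c + 1 → f z ≠ 0 →
        ∀ y : OrdinalSegment η, d < (y : Ordinal.{u}) → y ≤ p → f y = f p := by
    intro c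
    by_cases hc : c < ω_ 2
    · have hc1 : c + 1 < ω_ 2 := hlim.add_one_lt hc
      obtain ⟨d, hd, hdf⟩ := exists_forall_mem_eq_of_countable hp
        (hM.countable_of_succ ⟨c + 1, zero_le, hc1.le.trans hη⟩ c rfl)
      refine ⟨d, fun _ => ⟨hd, fun f hf z hz hfz y hy hyp => ?_⟩⟩
      obtain rfl : z = ⟨c + 1, zero_le, hc1.le.trans hη⟩ := Subtype.ext hz
      exact hdf f ⟨hf, hfz⟩ y hy hyp
    · exact ⟨0, fun h => absurd h hc⟩
  choose d hd using hstep
  obtain ⟨δ, hδ, hcof, hclosed⟩ :=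
    Ordinal.exists_closed_point_aleph0_lt_cof d fun c hc => (hd c hc).1
  have hδ1 : δ + 1 < ω_ 2 := hlim.add_one_lt hδ
  let x : OrdinalSegment η := ⟨δ, zero_le, hδ.le.trans hη⟩
  let x' : OrdinalSegment η := ⟨δ + 1, zero_le, hδ1.le.trans hη⟩
  refine hM.not_countable_of_aleph0_lt_cof hdense (x := x) hcof
    ((hM.countable_of_succ x' δ rfl).mono ?_)
  rintro f ⟨hf, hfx⟩
  refine ⟨hf, ?_⟩
  -- `f` is already nonzero at some `c + 1 < δ`, and `d c < δ` by closure, so `f` is constant from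
  -- `δ` to `ω_ 2`.
  obtain ⟨c, hc, hcf⟩ := exists_forall_eq_of_aleph0_lt_cof (x := x) hcof f
  have hcδ : c + 1 < δ :=
    (Ordinal.one_lt_cof_iff.1 (Cardinal.one_lt_aleph0.trans hcof)).add_one_lt hc
  have hc2 : c + 1 < ω_ 2 := hcδ.trans hδ
  have hz : f ⟨c + 1, zero_le, hc2.le.trans hη⟩ ≠ 0 := by
    rw [hcf _ (lt_add_one c) hcδ.le]
    exact hfx
  have hconst := (hd c ((lt_add_one c).trans hc2)).2 f hf _ rfl hz
  have hdc : d c < δ := hclosed c hc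
  rw [hconst x' (hdc.trans (lt_add_one δ)) hδ1.le, ← hconst x hdc hδ.le]
  exact hfx

end Main

end Proofs

theorem mainTheorem8 (𝕜 : Type*) [RCLike 𝕜] (η : Ordinal.{u}) :
    [IsOnePlichko 𝕜 C(OrdinalSegment η, 𝕜),
      IsSigmaSubspace (ordinalD 𝕜 η),
      η < ω_ 2].TFAE := by
  tfae_have 1 → 3 := IsOnePlichko.lt_omega_two
  tfae_have 3 → 2 := isSigmaSubspace_ordinalD
  tfae_have 2 → 1 := fun h => ⟨_, h, isOneNorming_ordinalD⟩
  tfae_finish
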